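/- Let $\mathbb{C}$ be a semi-abelian category, that is, a pointed, Barr-exact, (Bourn-)protomodular category with binary coproducts. Morphisms $f:A\to C$ and $g:B\to C$ are said to commute if there is $\varphi:A\times B\to C$ with $\varphi\langle 1,0\rangle=f$ and $\varphi\langle 0,1\rangle=g$; a morphism into $A$ is central if it commutes with $1_A$. The (Huq) commutator $[f,g]$ of $f$ and $g$ is initial amongst those normal monomorphisms $n$ with codomain $C$ for which $\mathrm{coker}(n)f$ and $\mathrm{coker}(n)g$ commute; for $f=g=1_X$ we write $c:[X,X]\to X$ for it. Assume that $\mathbb{C}$ satisfies the condition (WNH) for each normal monomorphism $k:K\to A$, if the commutator $c$ of $1_K$ with itself exists, then $kc$ is the commutator of $k$ with itself. For objects $B$ and $X$ let $B\flat X$ denote the kernel of $[1,0]:B+X\to B$. The functor $B\flat-$ underlies a monad on $\mathbb{C}$, whose unit $X\to B\flat X$ and multiplication $B\flat(B\flat X)\to B\flat X$ are the restrictions to kernels of $\iota_2:X\to B+X$ and of $[\iota_1,\ker[1,0]]:B+(B\flat X)\to B+X$; an internal $B$-action $\chi:B\flat X\to X$ is an algebra structure for this monad, and a morphism of internal $B$-actions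 is a morphism of algebras. Let $f:X\to Z$ be a morphism in $\mathbb{C}$ whose kernel is central, and let $\chi_1,\chi_2:B\flat X\to X$ and $\zeta:B\flat Z\to Z$ be internal $B$-actions such that $f$ is a morphism of internal $B$-actions from both $(X,\chi_1)$ and $(X,\chi_2)$ to $(Z,\zeta)$. Then the commutator $c:[X,X]\to X$ exists, and $\chi_1$ and $\chi_2$ restrict to the same internal $B$-action on $[X,X]$: there is a unique internal $B$-action $\omega:B\flat[X,X]\to[X,X]$ such that $c$ is a morphism of internal $B$-actions from $([X,X],\omega)$ to both $(X,\chi_1)$ and $(X,\chi_2)$. -/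

import Mathlib

open CategoryTheory CategoryTheory.Limits

universe v u

namespace SemiAb

section Pointed

variable {C : Type u} [Category.{v} C] [HasZeroMorphisms C]

/-- The morphism `k` is a kernel of `f`. -/
def IsKernelOf {K A B : C} (k : K ⟶ A) (f : A ⟶ B) : Prop :=
  ∃ w : k ≫ f = 0, Nonempty (IsLimit (KernelFork.ofι k w))

/-- The morphism `q` is a cokernel of `f`. -/
def IsCokernelOf {A B Q : C} (q : B ⟶ Q) (f : A ⟶ B) : Prop :=
  ∃ w : f ≫ q = 0, Nonempty (IsColimit (CokernelCofork.ofπ q w))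

/-- A normal monomorphism is a kernel of some morphism. -/
def IsNormalMono {K A : C} (k : K ⟶ A) : Prop :=
  ∃ (B : C) (f : A ⟶ B), IsKernelOf k f

/-- A split extension `X ⟶ A ⇄ B`: the morphism `β` is a section of `α` and `κ` is a kernel
of `α`. -/
structure IsSplitExtension {X A B : C} (κ : X ⟶ A) (α : A ⟶ B) (β : B ⟶ A) : Prop where
  section_comp : β ≫ α = 𝟙 B
  isKernel : IsKernelOf κ α

/-- A morphism `(f, g, h)` between two rows `X ⟶ A ⇄ B` and `Z ⟶ E ⇄ D`. -/
structure IsSplitExtensionMorphism {X A B Z E D : C}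
    (κ : X ⟶ A) (α : A ⟶ B) (β : B ⟶ A) (σ : Z ⟶ E) (γ : E ⟶ D) (δ : D ⟶ E)
    (f : X ⟶ Z) (g : A ⟶ E) (h : B ⟶ D) : Prop where
  comm_kernel : κ ≫ g = f ≫ σ
  comm_section : β ≫ g = h ≫ δ
  comm_retraction : α ≫ h = g ≫ γ

variable (C) in
/-- The split short five lemma. For a finitely complete pointed category this is Bourn
protomodularity. -/
def SplitShortFive : Prop :=
  ∀ ⦃X A B Z E D : C⦄ (κ : X ⟶ A) (α : A ⟶ B) (β : B ⟶ A)
    (σ : Z ⟶ E) (γ : E ⟶ D) (δ : D ⟶ E) (f : X ⟶ Z) (g : A ⟶ E) (h : B ⟶ D),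
    IsSplitExtension κ α β → IsSplitExtension σ γ δ →
    IsSplitExtensionMorphism κ α β σ γ δ f g h → IsIso f → IsIso h → IsIso g

variable (C) in
/-- A semi-abelian category: a category with a zero object which is regular (in particular
finitely complete), has binary coproducts, is protomodular, and in which every internal
equivalence relation is the kernel pair of some morphism. -/
class SemiAbelian : Prop where
  hasZeroObject : HasZeroObject C
  regular : Regular C
  hasBinaryCoproducts : HasBinaryCoproducts C
  splitShortFive : SplitShortFive C
  effective : ∀ ⦃R A : C⦄ (p₁ p₂ : R ⟶ A), IsEquivalenceRelation p₁ p₂ →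
    ∃ (Q : C) (q : A ⟶ Q), IsKernelPair q p₁ p₂

attribute [instance] SemiAbelian.hasZeroObject SemiAbelian.regular
  SemiAbelian.hasBinaryCoproducts

/-- Two morphisms with the same codomain (Huq-)commute if they have a cooperator
`φ : A ⨯ B ⟶ E`. -/
def HuqCommute [HasBinaryProducts C] {A B E : C} (f : A ⟶ E) (g : B ⟶ E) : Prop :=
  ∃ φ : A ⨯ B ⟶ E, prod.lift (𝟙 A) 0 ≫ φ = f ∧ prod.lift 0 (𝟙 B) ≫ φ = g

/-- A morphism into `A` is central if it commutes with the identity of `A`. -/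
def IsCentral [HasBinaryProducts C] {K A : C} (k : K ⟶ A) : Prop :=
  HuqCommute k (𝟙 A)

/-- `n` is a normal monomorphism whose cokernel makes `f` and `g` commute. -/
def CommuteModulo [HasBinaryProducts C] {A B E N : C} (f : A ⟶ E) (g : B ⟶ E)
    (n : N ⟶ E) : Prop :=
  IsNormalMono n ∧
    ∃ (Q : C) (q : E ⟶ Q), IsCokernelOf q n ∧ HuqCommute (f ≫ q) (g ≫ q)

/-- `c` is the Huq commutator of `f` and `g`: it is initial among the normal monomorphisms whose
cokernel makes `f` and `g` commute. (A factorization through a monomorphism is automatically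
unique.) -/
structure IsHuqCommutator [HasBinaryProducts C] {A B E N : C} (f : A ⟶ E) (g : B ⟶ E)
    (c : N ⟶ E) : Prop where
  commuteModulo : CommuteModulo f g c
  initial : ∀ ⦃M : C⦄ (n : M ⟶ E), CommuteModulo f g n → ∃ t : N ⟶ M, t ≫ n = c

variable (C) in
/-- The condition (WNH): for each normal monomorphism `k : K ⟶ A`, if `c` is the commutator of
`𝟙 K` with itself, then `c ≫ k` is the commutator of `k` with itself. -/
def WNH [HasBinaryProducts C] : Prop :=
  ∀ ⦃K A : C⦄ (k : K ⟶ A), IsNormalMono k →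
    ∀ ⦃N : C⦄ (c : N ⟶ K), IsHuqCommutator (𝟙 K) (𝟙 K) c → IsHuqCommutator k k (c ≫ k)

end Pointed

noncomputable section Actions

variable {C : Type u} [Category.{v} C] [HasZeroMorphisms C] [HasKernels C] [HasBinaryCoproducts C]

/-- The object `B ♭ X`, the kernel of `[1, 0] : B + X ⟶ B`. -/
abbrev flatObj (B X : C) : C :=
  kernel (coprod.desc (𝟙 B) (0 : X ⟶ B))

/-- The inclusion `B ♭ X ⟶ B + X`. -/
abbrev flatι (B X : C) : flatObj B X ⟶ B ⨿ X :=
  kernel.ι (coprod.desc (𝟙 B) (0 : X ⟶ B))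

/-- The morphism `B ♭ f`, the restriction of `1 + f` to kernels. -/
def flatMap (B : C) {X Y : C} (f : X ⟶ Y) : flatObj B X ⟶ flatObj B Y :=
  kernel.lift _ (flatι B X ≫ coprod.map (𝟙 B) f) (by
    have h : coprod.map (𝟙 B) f ≫ coprod.desc (𝟙 B) (0 : Y ⟶ B) = coprod.desc (𝟙 B) 0 := by
      ext <;> simp
    rw [Category.assoc, h, kernel.condition])

/-- The unit `X ⟶ B ♭ X`, through which the coproduct inclusion `X ⟶ B + X` factors. -/
def flatUnit (B X : C) : X ⟶ flatObj B X :=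
  kernel.lift _ coprod.inr (coprod.inr_desc _ _)

/-- The multiplication `B ♭ (B ♭ X) ⟶ B ♭ X`, the restriction to kernels of
`[ι₁, k] : B + (B ♭ X) ⟶ B + X`, where `k` is the kernel inclusion. -/
def flatMul (B X : C) : flatObj B (flatObj B X) ⟶ flatObj B X :=
  kernel.lift _ (flatι B (flatObj B X) ≫ coprod.desc coprod.inl (flatι B X)) (by
    have h : coprod.desc coprod.inl (flatι B X) ≫ coprod.desc (𝟙 B) (0 : X ⟶ B) =
        coprod.desc (𝟙 B) 0 := by
      ext <;> simp [coprod.inl_desc, coprod.inr_desc]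
    rw [Category.assoc, h, kernel.condition])

@[simp]
lemma flatMap_ι (B : C) {X Y : C} (f : X ⟶ Y) :
    flatMap B f ≫ flatι B Y = flatι B X ≫ coprod.map (𝟙 B) f :=
  kernel.lift_ι _ _ _

@[simp]
lemma flatUnit_ι (B X : C) : flatUnit B X ≫ flatι B X = coprod.inr :=
  kernel.lift_ι _ _ _

@[simp]
lemma flatMul_ι (B X : C) :
    flatMul B X ≫ flatι B X = flatι B (flatObj B X) ≫ coprod.desc coprod.inl (flatι B X) :=
  kernel.lift_ι _ _ _

/-- The monad `B ♭ -` on `C`. It is the monad of the adjunction whose right adjoint sends a split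
extension over `B` to its kernel and whose left adjoint sends `X` to `B ♭ X ⟶ B + X ⇄ B`. -/
def flatMonad (B : C) : Monad C where
  obj X := flatObj B X
  map f := flatMap B f
  map_id X := by
    rw [← cancel_mono (flatι B X)]
    simp
  map_comp f g := by
    rw [← cancel_mono (flatι B _)]
    simp only [Category.assoc, flatMap_ι]
    rw [← Category.assoc (flatMap B f), flatMap_ι]
    simp
  η :=
    { app := fun X => flatUnit B X
      naturality := fun X Y f => by
        rw [← cancel_mono (flatι B Y)]
        simp only [Functor.id_obj, Functor.id_map, Category.assoc, flatMap_ι]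
        rw [flatUnit_ι, ← Category.assoc, flatUnit_ι, coprod.inr_map] }
  μ :=
    { app := fun X => flatMul B X
      naturality := fun X Y f => by
        rw [← cancel_mono (flatι B Y)]
        simp only [Functor.comp_map, Category.assoc, flatMap_ι, flatMul_ι]
        rw [← Category.assoc, flatMap_ι, ← Category.assoc, flatMul_ι]
        simp only [Category.assoc]
        congr 1
        ext <;> simp [coprod.inl_desc, coprod.inr_desc] }
  assoc X := by
    rw [← cancel_mono (flatι B X)]
    simp only [Category.assoc, flatMul_ι]
    rw [← Category.assoc, flatMap_ι, ← Category.assoc, flatMul_ι]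
    simp only [Category.assoc]
    congr 1
    ext <;> simp [coprod.inl_desc, coprod.inr_desc]
  left_unit X := by
    rw [← cancel_mono (flatι B X)]
    simp only [Functor.id_obj, Category.assoc, flatMul_ι]
    rw [← Category.assoc, flatUnit_ι, coprod.inr_desc, Category.id_comp]
  right_unit X := by
    rw [← cancel_mono (flatι B X)]
    simp only [Functor.id_obj, Category.assoc, flatMul_ι]
    rw [← Category.assoc, flatMap_ι]
    simp

/-- `χ : B ♭ X ⟶ X` is an internal `B`-action on `X`, that is, the structure morphism of an
algebra of the monad `B ♭ -`. -/
def IsInternalAction (B : C) {X : C} (χ : flatObj B X ⟶ X) : Prop :=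
  (flatMonad B).η.app X ≫ χ = 𝟙 X ∧ (flatMonad B).μ.app X ≫ χ = (flatMonad B).map χ ≫ χ

/-- `f` is a morphism of internal `B`-actions `(X, χ) ⟶ (Y, ψ)`, that is, the underlying
morphism of a morphism of algebras of the monad `B ♭ -`. -/
def IsActionMorphism (B : C) {X Y : C} (f : X ⟶ Y) (χ : flatObj B X ⟶ X)
    (ψ : flatObj B Y ⟶ Y) : Prop :=
  (flatMonad B).map f ≫ ψ = χ ≫ f

end Actions

end SemiAb

/-!
The action on `[X, X]` is obtained from the free action on `F = B ♭ X`, and no semidirect products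
are needed.

Since `F` is normal in `B ⨿ X`, (WNH) makes `[F, F]` normal in `B ⨿ X` as well. As the free action
is conjugation inside `B ⨿ X`, it restricts to a morphism `ω : B ♭ [F, F] ⟶ [F, F]`
(`IsHuqCommutator.exists_flatMap_comp_flatMul`). Commutators are functorial
(`IsHuqCommutator.exists_map`), so the unit `X ⟶ F` induces `s : [X, X] ⟶ [F, F]` and `χ₁ : F ⟶ X`
induces `e : [F, F] ⟶ [X, X]`. The composite `B ♭ s ≫ ω ≫ e` is compatible with `χ₁` by the unit
law of the monad. It is compatible with `χ₂` too, because `e` is equally the restriction of `χ₂`: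
both `χ₁` and `χ₂` composed with `f` give `B ♭ f ≫ ζ`, and two morphisms which agree modulo a
central kernel agree on commutators (`IsHuqCommutator.comp_eq_comp_of_isCentral`), as they differ by
a morphism into an abelian object. Uniqueness and the laws of an action follow since
`[X, X] ⟶ X` is a monomorphism.

Existence of the commutator is the other half. The split short five lemma says that the kernel and
the section of a split extension jointly cover its middle object
(`IsSplitExtension.isIso_of_factors`). Consequently reflexive relations are equivalence relations,
so by exactness coequalizers exist (`hasCoequalizer_of_semiAbelian`), and regular epimorphisms are
cokernels (`isCokernelOf_kernelι`). A coequalizer then yields the universal quotient of `X` which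
commutes with itself, and `[X, X]` is its kernel.
-/

namespace SemiAb

attribute [local simp] prod.lift_fst prod.lift_snd prod.lift_fst_assoc prod.lift_snd_assoc
  pullback.lift_fst pullback.lift_snd pullback.lift_fst_assoc pullback.lift_snd_assoc
  coprod.inl_desc coprod.inr_desc coprod.inl_desc_assoc coprod.inr_desc_assoc

/-! ### Kernels and cokernels -/

section Kernels

variable {C : Type u} [Category.{v} C] [HasZeroMorphisms C]

lemma IsKernelOf.of_exists_lift {K A B : C} {k : K ⟶ A} {f : A ⟶ B} [Mono k] (w : k ≫ f = 0)
    (h : ∀ ⦃T : C⦄ (g : T ⟶ A), g ≫ f = 0 → ∃ l : T ⟶ K, l ≫ k = g) : IsKernelOf k f :=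
  ⟨w, ⟨KernelFork.IsLimit.ofι' k w fun g hg => ⟨(h g hg).choose, (h g hg).choose_spec⟩⟩⟩

lemma IsKernelOf.mono {K A B : C} {k : K ⟶ A} {f : A ⟶ B} (h : IsKernelOf k f) : Mono k := by
  obtain ⟨w, ⟨hk⟩⟩ := h
  exact ⟨fun _ _ e => Fork.IsLimit.hom_ext hk e⟩

lemma IsKernelOf.exists_lift {K A B T : C} {k : K ⟶ A} {f : A ⟶ B} (h : IsKernelOf k f)
    (g : T ⟶ A) (hg : g ≫ f = 0) : ∃ l : T ⟶ K, l ≫ k = g := by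
  obtain ⟨w, ⟨hk⟩⟩ := h
  exact ⟨_, (KernelFork.IsLimit.lift' hk g hg).2⟩

lemma isKernelOf_kernelι [HasKernels C] {A B : C} (f : A ⟶ B) : IsKernelOf (kernel.ι f) f :=
  .of_exists_lift (kernel.condition f) fun _ g hg => ⟨kernel.lift f g hg, kernel.lift_ι f g hg⟩

lemma IsCokernelOf.of_exists_desc {A B Q : C} {q : B ⟶ Q} {f : A ⟶ B} [Epi q] (w : f ≫ q = 0)
    (h : ∀ ⦃T : C⦄ (g : B ⟶ T), f ≫ g = 0 → ∃ l : Q ⟶ T, q ≫ l = g) : IsCokernelOf q f :=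
  ⟨w, ⟨CokernelCofork.IsColimit.ofπ' q w fun g hg =>
    ⟨(h g hg).choose, (h g hg).choose_spec⟩⟩⟩

lemma IsCokernelOf.exists_desc {A B Q T : C} {q : B ⟶ Q} {f : A ⟶ B} (h : IsCokernelOf q f)
    (g : B ⟶ T) (hg : f ≫ g = 0) : ∃ l : Q ⟶ T, q ≫ l = g := by
  obtain ⟨w, ⟨hq⟩⟩ := h
  exact ⟨_, (CokernelCofork.IsColimit.desc' hq g hg).2⟩

lemma IsNormalMono.mono {K A : C} {k : K ⟶ A} (h : IsNormalMono k) : Mono k := by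
  obtain ⟨_, _, hk⟩ := h
  exact hk.mono

/-- A normal monomorphism is the kernel of its cokernel. -/
lemma IsNormalMono.isKernelOf_cokernel {K A Q : C} {k : K ⟶ A} {q : A ⟶ Q}
    (hk : IsNormalMono k) (hq : IsCokernelOf q k) : IsKernelOf k q := by
  have := hk.mono
  obtain ⟨B, f, hf⟩ := hk
  obtain ⟨l, hl⟩ := hq.exists_desc f hf.1
  refine .of_exists_lift hq.1 fun T g hg => hf.exists_lift g ?_
  rw [← hl, reassoc_of% hg, zero_comp]

end Kernels

/-! ### Split extensions, the Mal'tsev property and coequalizers -/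

section Protomodular

variable {C : Type u} [Category.{v} C] [HasZeroMorphisms C] [SemiAbelian C]

/-- In a split extension the kernel and the section are jointly extremal-epimorphic: a subobject
containing both is everything. -/
lemma IsSplitExtension.isIso_of_factors {X A B M : C} {κ : X ⟶ A} {α : A ⟶ B} {β : B ⟶ A}
    (h : IsSplitExtension κ α β) (m : M ⟶ A) [Mono m] (k : X ⟶ M) (b : B ⟶ M)
    (hk : k ≫ m = κ) (hb : b ≫ m = β) : IsIso m := by
  have := h.isKernel.mono
  have : Mono k := by
    have : Mono (k ≫ m) := hk ▸ inferInstance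
    exact mono_of_mono k m
  have h' : IsSplitExtension k (m ≫ α) b := by
    refine ⟨by rw [reassoc_of% hb, h.section_comp], .of_exists_lift ?_ fun T g hg => ?_⟩
    · rw [reassoc_of% hk, h.isKernel.1]
    · obtain ⟨l, hl⟩ := h.isKernel.exists_lift (g ≫ m) (by simpa using hg)
      exact ⟨l, by rw [← cancel_mono m, Category.assoc, hk, hl]⟩
  exact SemiAbelian.splitShortFive k (m ≫ α) b κ α β (𝟙 X) m (𝟙 B) h' h
    ⟨by simpa using hk, by simpa using hb, by simp⟩ inferInstance inferInstance

lemma IsSplitExtension.hom_ext {X A B Y : C} {κ : X ⟶ A} {α : A ⟶ B} {β : B ⟶ A}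
    (h : IsSplitExtension κ α β) {u w : A ⟶ Y} (hκ : κ ≫ u = κ ≫ w) (hβ : β ≫ u = β ≫ w) :
    u = w := by
  have := h.isIso_of_factors (equalizer.ι u w) (equalizer.lift κ hκ) (equalizer.lift β hβ)
    (equalizer.lift_ι _ _) (equalizer.lift_ι _ _)
  exact eq_of_epi_equalizer

lemma isSplitExtension_prod (A B : C) :
    IsSplitExtension (prod.lift (𝟙 A) (0 : A ⟶ B)) prod.snd (prod.lift (0 : B ⟶ A) (𝟙 B)) := by
  have : Mono (prod.lift (𝟙 A) (0 : A ⟶ B)) := mono_of_mono_fac (prod.lift_fst (𝟙 A) 0)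
  refine ⟨by simp, .of_exists_lift (by simp) fun T g hg => ⟨g ≫ prod.fst, ?_⟩⟩
  ext <;> simp [hg]

lemma isSplitExtension_kernelPair {A Q : C} (q : A ⟶ Q) :
    IsSplitExtension
      (pullback.lift 0 (kernel.ι q) (by simp) : kernel q ⟶ pullback q q)
      (pullback.fst q q) (pullback.lift (𝟙 A) (𝟙 A) rfl) := by
  have : Mono (pullback.lift 0 (kernel.ι q) (by simp) : kernel q ⟶ pullback q q) :=
    mono_of_mono_fac (pullback.lift_snd 0 (kernel.ι q) _)
  refine ⟨pullback.lift_fst _ _ _, .of_exists_lift (pullback.lift_fst _ _ _) fun S l hl => ?_⟩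
  refine ⟨kernel.lift q (l ≫ pullback.snd q q) ?_, ?_⟩
  · rw [Category.assoc, ← pullback.condition, reassoc_of% hl, zero_comp]
  · ext <;> simp [hl]

/-- The pullback of two split epimorphisms `α` and `γ` is jointly covered by the inclusions of `A`
and `B` induced by sections of `γ` and `α`: the kernel of its first projection is contained in the
image of the second inclusion. The section of `γ` enters only through the first inclusion `a ≫ m`,
which need only be a section of the projection. -/
lemma isIso_of_factors_pullback {A B R M : C} (α : A ⟶ R) (β : R ⟶ A) (γ : B ⟶ R)
    (m : M ⟶ pullback α γ) [Mono m] (a : A ⟶ M) (b : B ⟶ M)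
    (ha : a ≫ m ≫ pullback.fst α γ = 𝟙 A)
    (hb₁ : b ≫ m ≫ pullback.fst α γ = γ ≫ β) (hb₂ : b ≫ m ≫ pullback.snd α γ = 𝟙 B) :
    IsIso m := by
  have h : IsSplitExtension (kernel.ι γ ≫ b ≫ m) (pullback.fst α γ) (a ≫ m) := by
    have : Mono (kernel.ι γ ≫ b ≫ m) :=
      mono_of_mono_fac
        (show (kernel.ι γ ≫ b ≫ m) ≫ pullback.snd α γ = kernel.ι γ by simp [hb₂])
    refine ⟨by simpa using ha, .of_exists_lift (by simp [hb₁]) fun T g hg => ?_⟩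
    refine ⟨kernel.lift γ (g ≫ pullback.snd α γ) ?_, ?_⟩
    · rw [Category.assoc, ← pullback.condition, reassoc_of% hg, zero_comp]
    · ext
      · simp [hb₁, hg, ← pullback.condition_assoc, reassoc_of% hg]
      · simp [hb₂]
  exact h.isIso_of_factors m (kernel.ι γ ≫ b) a (Category.assoc _ _ _) rfl

/-- Reflexive relations are difunctional: if `a R b`, `c R b` and `c R d`, then `a R d`. The
quadruples `(a, b, c, d)` form the pullback of two split epimorphisms over `R`, and the claim holds
for the quadruples `(a, b, c, b)` by `a R b` and for `(c, b, c, d)` by `c R d`. -/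
lemma exists_difunctional {R E T : C} {p₁ p₂ : R ⟶ E} (r : ReflexiveRelation p₁ p₂)
    (x y z : T ⟶ R) (hxy : x ≫ p₂ = y ≫ p₂) (hyz : y ≫ p₁ = z ≫ p₁) :
    ∃ w : T ⟶ R, w ≫ p₁ = x ≫ p₁ ∧ w ≫ p₂ = z ≫ p₂ := by
  let α := pullback.snd p₂ p₂
  let β : R ⟶ pullback p₂ p₂ := pullback.lift (𝟙 R) (𝟙 R) rfl
  let γ := pullback.fst p₁ p₁
  let δ : R ⟶ pullback p₁ p₁ := pullback.lift (𝟙 R) (𝟙 R) rfl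
  have hβ : β ≫ α = 𝟙 R := pullback.lift_snd _ _ _
  have hβ' : β ≫ pullback.fst p₂ p₂ = 𝟙 R := pullback.lift_fst _ _ _
  have hδ : δ ≫ γ = 𝟙 R := pullback.lift_fst _ _ _
  have hδ' : δ ≫ pullback.snd p₁ p₁ = 𝟙 R := pullback.lift_snd _ _ _
  have hα : pullback.fst p₂ p₂ ≫ p₂ = α ≫ p₂ := pullback.condition
  have hγ : γ ≫ p₁ = pullback.snd p₁ p₁ ≫ p₁ := pullback.condition
  have hR : Mono (prod.lift p₁ p₂) := ⟨fun f g h => r.right_cancellation f g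
    (by simpa using h =≫ prod.fst) (by simpa using h =≫ prod.snd)⟩
  let e : pullback α γ ⟶ E ⨯ E := prod.lift (pullback.fst α γ ≫ pullback.fst p₂ p₂ ≫ p₁)
    (pullback.snd α γ ≫ pullback.snd p₁ p₁ ≫ p₂)
  let i₁ : pullback p₂ p₂ ⟶ pullback α γ := pullback.lift (𝟙 _) (α ≫ δ) (by simp [hδ])
  let i₂ : pullback p₁ p₁ ⟶ pullback α γ := pullback.lift (γ ≫ β) (𝟙 _) (by simp [hβ])
  let a : pullback p₂ p₂ ⟶ pullback (prod.lift p₁ p₂) e :=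
    pullback.lift (pullback.fst p₂ p₂) i₁ (by ext <;> simp [i₁, e, reassoc_of% hδ', hα])
  let b : pullback p₁ p₁ ⟶ pullback (prod.lift p₁ p₂) e :=
    pullback.lift (pullback.snd p₁ p₁) i₂
      (by ext <;> simp [i₂, e, reassoc_of% hβ', hγ])
  have : IsIso (pullback.snd (prod.lift p₁ p₂) e) :=
    isIso_of_factors_pullback α β γ _ a b (by simp [a, i₁])
      (by simp [b, i₂]) (by simp [b, i₂])
  let t := inv (pullback.snd (prod.lift p₁ p₂) e) ≫ pullback.fst (prod.lift p₁ p₂) e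
  have ht : t ≫ prod.lift p₁ p₂ = e := by
    simp only [t, Category.assoc, pullback.condition, IsIso.inv_hom_id_assoc]
  have ht₁ : t ≫ p₁ = pullback.fst α γ ≫ pullback.fst p₂ p₂ ≫ p₁ := by
    simpa [e] using ht =≫ prod.fst
  have ht₂ : t ≫ p₂ = pullback.snd α γ ≫ pullback.snd p₁ p₁ ≫ p₂ := by
    simpa [e] using ht =≫ prod.snd
  refine ⟨pullback.lift (pullback.lift x y hxy) (pullback.lift y z hyz) (by simp [α, γ]) ≫ t,
    ?_, ?_⟩
  · simp [ht₁]
  · simp [ht₂]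

/-- A semi-abelian category is a Mal'tsev category: symmetry and transitivity are instances of
difunctionality, applied to `b R b`, `a R b`, `a R a` and to `a R b`, `b R b`, `b R c`. -/
lemma isEquivalenceRelation_of_reflexiveRelation {R E : C} {p₁ p₂ : R ⟶ E}
    (r : ReflexiveRelation p₁ p₂) : IsEquivalenceRelation p₁ p₂ := by
  obtain ⟨s, hs₁, hs₂⟩ := exists_difunctional r (p₂ ≫ r.r) (𝟙 R) (p₁ ≫ r.r) (by simp) (by simp)
  obtain ⟨t, ht₁, ht₂⟩ := exists_difunctional r (pullback.fst p₂ p₁)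
    (pullback.fst p₂ p₁ ≫ p₂ ≫ r.r) (pullback.snd p₂ p₁) (by simp)
    (by simp [pullback.condition])
  exact EquivalenceRelation.isEquivalenceRelation
    { toReflexiveRelation := r
      s := s
      symmetry₁ := by simpa using hs₁
      symmetry₂ := by simpa using hs₂
      c := pullback.cone p₂ p₁
      isLimit := pullback.isLimit p₂ p₁
      t := t
      transitivity₁ := ht₁
      transitivity₂ := ht₂ }

/-- Coequalizers exist: the coequalizer of `u, w : A ⟶ E` is the quotient of `E` by the image in
`E ⨯ E` of the reflexive graph `A ⨿ E ⇉ E` they generate, which is an equivalence relation by the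
Mal'tsev property and effective by exactness. -/
lemma hasCoequalizer_of_semiAbelian {A E : C} (u w : A ⟶ E) : HasCoequalizer u w := by
  let F := Regular.strongEpiMonoFactorisation
    (prod.lift (coprod.desc u (𝟙 E)) (coprod.desc w (𝟙 E)))
  have h₁ : F.e ≫ F.m ≫ prod.fst = coprod.desc u (𝟙 E) := by rw [F.fac_assoc, prod.lift_fst]
  have h₂ : F.e ≫ F.m ≫ prod.snd = coprod.desc w (𝟙 E) := by rw [F.fac_assoc, prod.lift_snd]
  let r : ReflexiveRelation (F.m ≫ prod.fst) (F.m ≫ prod.snd) :=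
    { right_cancellation := fun T f g h h' => by
        rw [← cancel_mono F.m]
        ext
        · simpa using h
        · simpa using h'
      r := coprod.inr ≫ F.e
      reflexivity₁ := by rw [Category.assoc, h₁, coprod.inr_desc]
      reflexivity₂ := by rw [Category.assoc, h₂, coprod.inr_desc] }
  obtain ⟨Q, q, hq⟩ := SemiAbelian.effective _ _ (isEquivalenceRelation_of_reflexiveRelation r)
  have := Regular.hasCoequalizer_of_isKernelPair hq
  let π := coequalizer.π (F.m ≫ prod.fst) (F.m ≫ prod.snd)
  have hπ : coprod.desc u (𝟙 E) ≫ π = coprod.desc w (𝟙 E) ≫ π := by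
    refine (h₁ =≫ π).symm.trans (Eq.trans ?_ (h₂ =≫ π))
    simpa only [Category.assoc] using
      F.e ≫= coequalizer.condition (F.m ≫ prod.fst) (F.m ≫ prod.snd)
  have huw : u ≫ π = w ≫ π := by simpa using coprod.inl ≫= hπ
  refine ⟨⟨Cofork.ofπ π huw, Cofork.IsColimit.mk' _ fun s => ?_⟩⟩
  have hs : (F.m ≫ prod.fst) ≫ s.π = (F.m ≫ prod.snd) ≫ s.π := by
    rw [← cancel_epi F.e, ← Category.assoc, h₁, ← Category.assoc, h₂]
    ext <;> simp [s.condition]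
  refine ⟨coequalizer.desc s.π hs, coequalizer.π_desc _ _, fun {l} hl => ?_⟩
  rw [← cancel_epi π]
  exact hl.trans (coequalizer.π_desc _ _).symm

/-- A regular epimorphism is the cokernel of its kernel. Every morphism killing the kernel
coequalizes the two projections of the kernel pair, because the diagonal and the kernel of a
projection jointly cover the kernel pair. -/
lemma isCokernelOf_kernelι {A Q : C} (q : A ⟶ Q) [IsRegularEpi q] :
    IsCokernelOf q (kernel.ι q) := by
  refine .of_exists_desc (kernel.condition q) fun T g hg => ?_
  refine IsRegularEpi.exists_of_isKernelPair q (.of_hasPullback q) g ?_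
  refine (isSplitExtension_kernelPair q).hom_ext ?_ ?_ <;> simp [hg]

end Protomodular

/-! ### Commutators of objects and central kernels -/

section Commutators

variable {C : Type u} [Category.{v} C] [HasZeroMorphisms C] [SemiAbelian C]

lemma HuqCommute.precomp {A B A' B' E : C} {f : A ⟶ E} {g : B ⟶ E} (h : HuqCommute f g)
    (a : A' ⟶ A) (b : B' ⟶ B) : HuqCommute (a ≫ f) (b ≫ g) := by
  obtain ⟨φ, rfl, rfl⟩ := h
  refine ⟨prod.map a b ≫ φ, ?_, ?_⟩ <;> simp [prod.lift_map_assoc, prod.comp_lift_assoc]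

lemma isRegularEpi_coprodToProd (A B : C) :
    IsRegularEpi (coprod.desc (prod.lift (𝟙 A) 0) (prod.lift 0 (𝟙 B)) : A ⨿ B ⟶ A ⨯ B) := by
  have : ExtremalEpi
      (coprod.desc (prod.lift (𝟙 A) 0) (prod.lift 0 (𝟙 B)) : A ⨿ B ⟶ A ⨯ B) :=
    .mk_of_hasEqualizers _ fun M p i hp _ =>
      (isSplitExtension_prod A B).isIso_of_factors i (coprod.inl ≫ p) (coprod.inr ≫ p)
        (by simp [hp]) (by simp [hp])
  infer_instance

/-- The universal quotient `q` of `X` commuting with itself: it is the coequalizer of the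
composites with the codiagonal of the kernel pair of `X ⨿ X ⟶ X ⨯ X`. -/
lemma exists_universal_huqCommute (X : C) :
    ∃ (Q : C) (q : X ⟶ Q), IsRegularEpi q ∧ HuqCommute q q ∧
      ∀ ⦃Y : C⦄ (d : X ⟶ Y), HuqCommute d d → ∃ l : Q ⟶ Y, q ≫ l = d := by
  let σ : X ⨿ X ⟶ X ⨯ X := coprod.desc (prod.lift (𝟙 X) 0) (prod.lift 0 (𝟙 X))
  have : IsRegularEpi σ := isRegularEpi_coprodToProd X X
  let u := pullback.fst σ σ ≫ coprod.desc (𝟙 X) (𝟙 X)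
  let w := pullback.snd σ σ ≫ coprod.desc (𝟙 X) (𝟙 X)
  have : HasCoequalizer u w := hasCoequalizer_of_semiAbelian u w
  refine ⟨_, coequalizer.π u w, inferInstance, ?_, fun Y d hd => ?_⟩
  · obtain ⟨φ, hφ⟩ := IsRegularEpi.exists_of_isKernelPair σ (.of_hasPullback σ)
      (coprod.desc (𝟙 X) (𝟙 X) ≫ coequalizer.π u w)
      (by simpa [u, w] using coequalizer.condition u w)
    exact ⟨φ, by simpa [σ] using coprod.inl ≫= hφ, by simpa [σ] using coprod.inr ≫= hφ⟩
  · obtain ⟨φ, h₁, h₂⟩ := hd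
    have h : coprod.desc (𝟙 X) (𝟙 X) ≫ d = σ ≫ φ := by
      ext
      · simp [σ, h₁]
      · simp [σ, h₂]
    refine ⟨coequalizer.desc d ?_, coequalizer.π_desc _ _⟩
    simp only [u, w, Category.assoc, h, pullback.condition_assoc]

/-- The commutator `[X, X]` is the kernel of the universal quotient of `X` commuting with
itself. -/
lemma exists_isHuqCommutator_comp_eq_zero (X : C) :
    ∃ (D : C) (c : D ⟶ X), IsHuqCommutator (𝟙 X) (𝟙 X) c ∧
      ∀ ⦃Y : C⦄ (d : X ⟶ Y), HuqCommute d d → c ≫ d = 0 := by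
  obtain ⟨Q, q, _, hq, hu⟩ := exists_universal_huqCommute X
  have hz : ∀ ⦃Y : C⦄ (d : X ⟶ Y), HuqCommute d d → kernel.ι q ≫ d = 0 := fun Y d hd => by
    obtain ⟨l, rfl⟩ := hu d hd
    rw [kernel.condition_assoc, zero_comp]
  refine ⟨_, kernel.ι q, ⟨⟨⟨_, q, isKernelOf_kernelι q⟩, _, q, isCokernelOf_kernelι q, ?_⟩, ?_⟩, hz⟩
  · simpa using hq
  · rintro M n ⟨hn, Q', q', hq', hc⟩
    exact (hn.isKernelOf_cokernel hq').exists_lift _ (hz q' (by simpa using hc))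

lemma IsHuqCommutator.comp_eq_zero {X Y D : C} {c : D ⟶ X} (hc : IsHuqCommutator (𝟙 X) (𝟙 X) c)
    {d : X ⟶ Y} (hd : HuqCommute d d) : c ≫ d = 0 := by
  obtain ⟨D', c', hc', hz⟩ := exists_isHuqCommutator_comp_eq_zero X
  obtain ⟨t, rfl⟩ := hc.initial c' hc'.commuteModulo
  rw [Category.assoc, hz d hd, comp_zero]

/-- Morphisms restrict to commutators. -/
lemma IsHuqCommutator.exists_map {X Y D E : C} {c : D ⟶ X} {c' : E ⟶ Y}
    (hc : IsHuqCommutator (𝟙 X) (𝟙 X) c) (hc' : IsHuqCommutator (𝟙 Y) (𝟙 Y) c') (g : X ⟶ Y) :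
    ∃ e : D ⟶ E, e ≫ c' = c ≫ g := by
  obtain ⟨hn, Q, q, hq, hqq⟩ := hc'.commuteModulo
  rw [Category.id_comp] at hqq
  refine (hn.isKernelOf_cokernel hq).exists_lift _ ?_
  rw [Category.assoc, hc.comp_eq_zero (hqq.precomp g g)]

/-- If the kernel `K` of `f : X ⟶ Z` is central, with cooperator `φ : K ⨯ X ⟶ X`, then
`(k, x) ↦ (x, φ (k, x))` is an isomorphism from `K ⨯ X` to the kernel pair of `f`. So of two
morphisms which agree modulo `K`, the second is the translate of the first by a morphism into
`K`. -/
lemma exists_difference {X Z Y : C} (f : X ⟶ Z) {φ : kernel f ⨯ X ⟶ X}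
    (h₁ : prod.lift (𝟙 _) 0 ≫ φ = kernel.ι f) (h₂ : prod.lift 0 (𝟙 X) ≫ φ = 𝟙 X)
    (g h : Y ⟶ X) (w : g ≫ f = h ≫ f) : ∃ d : Y ⟶ kernel f, prod.lift d g ≫ φ = h := by
  have hφ : prod.snd ≫ f = φ ≫ f := by
    refine (isSplitExtension_prod (kernel f) X).hom_ext ?_ ?_
    · simp [reassoc_of% h₁]
    · simp [reassoc_of% h₂]
  let m : kernel f ⨯ X ⟶ pullback f f := pullback.lift prod.snd φ hφ
  have : IsIso m := SemiAbelian.splitShortFive _ _ _ _ _ _ (𝟙 _) m (𝟙 X)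
    (isSplitExtension_prod (kernel f) X) (isSplitExtension_kernelPair f)
    ⟨by ext <;> simp [m, h₁], by ext <;> simp [m, h₂], by simp [m]⟩ inferInstance inferInstance
  let t := pullback.lift g h w ≫ inv m
  have ht : t ≫ m = pullback.lift g h w := by simp [t]
  have ht₁ : t ≫ prod.snd = g := by simpa [m] using ht =≫ pullback.fst f f
  have ht₂ : t ≫ φ = h := by simpa [m] using ht =≫ pullback.snd f f
  refine ⟨t ≫ prod.fst, ?_⟩
  rw [← ht₂]
  congr 1
  ext <;> simp [ht₁]

/-- Morphisms which agree modulo a central kernel agree on commutators: they differ by a morphism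
into an abelian object, and such a morphism is trivial on commutators. -/
lemma IsHuqCommutator.comp_eq_comp_of_isCentral {X Z Y D : C} {c : D ⟶ Y}
    (hc : IsHuqCommutator (𝟙 Y) (𝟙 Y) c) (f : X ⟶ Z) (hf : IsCentral (kernel.ι f))
    (g h : Y ⟶ X) (w : g ≫ f = h ≫ f) : c ≫ g = c ≫ h := by
  -- The cooperator of `kernel.ι f` with itself lands in the kernel, which is thus abelian.
  have hf' : HuqCommute (𝟙 (kernel f)) (𝟙 (kernel f)) := by
    obtain ⟨φ, h₁, h₂⟩ := HuqCommute.precomp hf (𝟙 _) (kernel.ι f)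
    refine ⟨kernel.lift f φ ?_, ?_, ?_⟩
    · refine (isSplitExtension_prod _ _).hom_ext ?_ ?_
      · simp [reassoc_of% h₁]
      · simp [reassoc_of% h₂]
    · rw [← cancel_mono (kernel.ι f)]
      simp [h₁]
    · rw [← cancel_mono (kernel.ι f)]
      simp [h₂]
  obtain ⟨φ, h₁, h₂⟩ := hf
  obtain ⟨d, rfl⟩ := exists_difference f h₁ h₂ g h w
  have hd : c ≫ d = 0 := hc.comp_eq_zero (by simpa using hf'.precomp d d)
  have hl : c ≫ prod.lift d g = (c ≫ g) ≫ prod.lift 0 (𝟙 X) := by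
    ext <;> simp [hd]
  rw [reassoc_of% hl, h₂, Category.comp_id]

end Commutators

/-! ### Internal actions -/

section Actions

variable {C : Type u} [Category.{v} C] [HasZeroMorphisms C] [SemiAbelian C]

lemma flatMap_comp (B : C) {X Y Z : C} (f : X ⟶ Y) (g : Y ⟶ Z) :
    flatMap B (f ≫ g) = flatMap B f ≫ flatMap B g :=
  (flatMonad B).map_comp f g

/-- Under (WNH) the commutator of the free action `B ♭ X` is stable under the action of `B`: it is
normal in `B ⨿ X`, so that `B ♭ D ⟶ B ⨿ D ⟶ B ⨿ X` lands in it. -/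
lemma IsHuqCommutator.exists_flatMap_comp_flatMul (hC : WNH C) {B X D : C} {c : D ⟶ flatObj B X}
    (hc : IsHuqCommutator (𝟙 _) (𝟙 _) c) :
    ∃ ω : flatObj B D ⟶ D, ω ≫ c = flatMap B c ≫ flatMul B X := by
  obtain ⟨⟨Q, q, hq⟩, -⟩ :=
    (hC (flatι B X) ⟨_, _, isKernelOf_kernelι _⟩ c hc).commuteModulo
  -- Modulo `D` the map `B ⨿ D ⟶ B ⨿ X` factors through `B ⨿ D ⟶ B`, which kills `B ♭ D`.
  have hz : (flatMap B c ≫ flatMul B X ≫ flatι B X) ≫ q = 0 := by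
    have h : coprod.map (𝟙 B) c ≫ coprod.desc coprod.inl (flatι B X) ≫ q =
        coprod.desc (𝟙 B) (0 : D ⟶ B) ≫ coprod.inl ≫ q := by
      have := hq.1
      ext
      · simp
      · simpa using this
    rw [flatMul_ι, ← Category.assoc (flatMap B c), flatMap_ι]
    simp only [Category.assoc]
    rw [h, kernel.condition_assoc, zero_comp]
  obtain ⟨ω, hω⟩ := hq.exists_lift _ hz
  exact ⟨ω, by rw [← cancel_mono (flatι B X), Category.assoc, hω, Category.assoc]⟩

/-- A map `ω : B ♭ D ⟶ D` compatible with an action along a monomorphism is an action. -/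
lemma IsInternalAction.of_mono {B D X : C} {c : D ⟶ X} [Mono c] {ω : flatObj B D ⟶ D}
    {χ : flatObj B X ⟶ X} (hχ : IsInternalAction B χ) (hc : IsActionMorphism B c ω χ) :
    IsInternalAction B ω := by
  obtain ⟨h₁, h₂⟩ := hχ
  change flatUnit B X ≫ χ = 𝟙 X at h₁
  change flatMul B X ≫ χ = flatMap B χ ≫ χ at h₂
  change flatMap B c ≫ χ = ω ≫ c at hc
  have hη : flatUnit B D ≫ flatMap B c = c ≫ flatUnit B X :=
    ((flatMonad B).η.naturality c).symm
  have hμ : flatMul B D ≫ flatMap B c = flatMap B (flatMap B c) ≫ flatMul B X :=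
    ((flatMonad B).μ.naturality c).symm
  constructor
  · change flatUnit B D ≫ ω = 𝟙 D
    rw [← cancel_mono c, Category.assoc, ← hc, reassoc_of% hη, h₁, Category.comp_id,
      Category.id_comp]
  · change flatMul B D ≫ ω = flatMap B ω ≫ ω
    rw [← cancel_mono c, Category.assoc, Category.assoc, ← hc, reassoc_of% hμ, h₂,
      ← Category.assoc, ← Category.assoc, ← flatMap_comp, ← flatMap_comp, hc]

end Actions

end SemiAb

theorem proposition2p4 {C : Type u} [Category.{v} C] [HasZeroMorphisms C]
    [SemiAb.SemiAbelian C] (hC : SemiAb.WNH C)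
    {B X Z : C} (f : X ⟶ Z) (hf : SemiAb.IsCentral (kernel.ι f))
    (χ₁ χ₂ : SemiAb.flatObj B X ⟶ X) (ζ : SemiAb.flatObj B Z ⟶ Z)
    (hχ₁ : SemiAb.IsInternalAction B χ₁) (hχ₂ : SemiAb.IsInternalAction B χ₂)
    (hζ : SemiAb.IsInternalAction B ζ)
    (h₁ : SemiAb.IsActionMorphism B f χ₁ ζ) (h₂ : SemiAb.IsActionMorphism B f χ₂ ζ) :
    (∃ (D : C) (c : D ⟶ X), SemiAb.IsHuqCommutator (𝟙 X) (𝟙 X) c) ∧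
    ∀ (D : C) (c : D ⟶ X), SemiAb.IsHuqCommutator (𝟙 X) (𝟙 X) c →
      ∃! ω : SemiAb.flatObj B D ⟶ D, SemiAb.IsInternalAction B ω ∧
        SemiAb.IsActionMorphism B c ω χ₁ ∧ SemiAb.IsActionMorphism B c ω χ₂ := by
  obtain ⟨D₀, c₀, hc₀, -⟩ := SemiAb.exists_isHuqCommutator_comp_eq_zero X
  refine ⟨⟨D₀, c₀, hc₀⟩, fun D c hc => ?_⟩
  have : Mono c := hc.commuteModulo.1.mono
  obtain ⟨F, k, hk, -⟩ := SemiAb.exists_isHuqCommutator_comp_eq_zero (SemiAb.flatObj B X)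
  obtain ⟨s, hs⟩ := hc.exists_map hk (SemiAb.flatUnit B X)
  obtain ⟨e, he⟩ := hk.exists_map hc χ₁
  obtain ⟨ω, hω⟩ := hk.exists_flatMap_comp_flatMul hC
  have he' : e ≫ c = k ≫ χ₂ :=
    he.trans (hk.comp_eq_comp_of_isCentral f hf χ₁ χ₂ (Eq.trans h₁.symm h₂))
  have key : ∀ χ : SemiAb.flatObj B X ⟶ X, e ≫ c = k ≫ χ →
      SemiAb.IsActionMorphism B c (SemiAb.flatMap B s ≫ ω ≫ e) χ := fun χ hχ => by
    -- The right unit law `B ♭ η ≫ μ = 𝟙` makes the detour through the free action invisible.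
    have hu : SemiAb.flatMap B (SemiAb.flatUnit B X) ≫ SemiAb.flatMul B X = 𝟙 _ :=
      (SemiAb.flatMonad B).right_unit X
    have hm : SemiAb.flatMap B s ≫ SemiAb.flatMap B k =
        SemiAb.flatMap B c ≫ SemiAb.flatMap B (SemiAb.flatUnit B X) := by
      rw [← SemiAb.flatMap_comp, ← SemiAb.flatMap_comp, hs]
    change SemiAb.flatMap B c ≫ χ = _
    rw [Category.assoc, Category.assoc, hχ, reassoc_of% hω, reassoc_of% hm, reassoc_of% hu]
  have k₁ := key χ₁ he
  refine ⟨_, ⟨hχ₁.of_mono k₁, k₁, key χ₂ he'⟩, fun ω' h => ?_⟩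
  rw [← cancel_mono c]
  exact Eq.trans h.2.1.symm k₁
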